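/- Let $k$ be an algebraically closed field of characteristic zero, let $R=k[x_{i,j} : 1\le i\le r,\ 0\le j\le n_i]$ be the $\mathbb{N}^r$-graded coordinate ring of $\mathbb{P}^{n_1}\times\cdots\times\mathbb{P}^{n_r}$ over $k$, with $\deg x_{i,j}=e_i$ the $i$-th standard basis vector of $\mathbb{N}^r$, and let $\mathbb{X}\subseteq\mathbb{P}^{n_1}\times\cdots\times\mathbb{P}^{n_r}$ be a finite set of points. Let $I_{\mathbb{X}}\subseteq R$ be the ideal generated by all multihomogeneous forms that vanish at every point of $\mathbb{X}$, and let $H_{\mathbb{X}}(\underline{i})=\dim_k (R/I_{\mathbb{X}})_{\underline{i}}$ for $\underline{i}\in\mathbb{N}^r$ be the Hilbert function of $\mathbb{X}$. The set $\mathbb{X}$ is called arithmetically Cohen-Macaulay (ACM) if $\dim R/I_{\mathbb{X}}=\operatorname{depth} R/I_{\mathbb{X}}=r$, where $\dim$ is the Krull dimension and $\operatorname{depth}$ is the depth with respect to the ideal generated by all the variables $x_{i,j}$. If there exist $\underline{i}=(i_1,\ldots,i_r)$ and $\underline{j}=(j_1,\ldots,j_r)$ in $\mathbb{N}^r$ such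 that $H_{\mathbb{X}}(\underline{i})=H_{\mathbb{X}}(\underline{j})=|\mathbb{X}|$ but $H_{\mathbb{X}}(\underline{k})\neq|\mathbb{X}|$, where $\underline{k}=(\min\{i_1,j_1\},\ldots,\min\{i_r,j_r\})$, then $\mathbb{X}$ is not ACM. -/

import Mathlib

namespace Multiprojective

/-- The multiprojective space `ℙ^{n 0} × ⋯ × ℙ^{n (r-1)}` over `k`. -/
abbrev Space (k : Type*) [Field k] {r : ℕ} (n : Fin r → ℕ) : Type _ :=
  (i : Fin r) → Projectivization k (Fin (n i + 1) → k)

/-- The indices `(i, j)`, `0 ≤ j ≤ n i`, of the multihomogeneous coordinates `x_{i,j}`. -/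
abbrev Var {r : ℕ} (n : Fin r → ℕ) : Type :=
  (i : Fin r) × Fin (n i + 1)

/-- The coordinate ring `R = k[x_{i,j}]` of the multiprojective space. -/
abbrev CoordRing (k : Type*) [Field k] {r : ℕ} (n : Fin r → ℕ) : Type _ :=
  MvPolynomial (Var n) k

/-- The multidegree of the variables: `deg x_{i,j} = e_i`. -/
def varDegree {r : ℕ} (n : Fin r → ℕ) : Var n → (Fin r → ℕ) :=
  fun v => Pi.single v.1 1

/-- The graded piece `R_d`: the space of multihomogeneous forms of multidegree `d`. -/
noncomputable def forms (k : Type*) [Field k] {r : ℕ} (n : Fin r → ℕ) (d : Fin r → ℕ) :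
    Submodule k (CoordRing k n) :=
  MvPolynomial.weightedHomogeneousSubmodule k (varDegree n) d

/-- The polynomial `F` is zero on (a choice of) multihomogeneous coordinates of `P`. It is only
used for multihomogeneous `F`, where the choice of the coordinates does not matter. -/
def VanishesAt {k : Type*} [Field k] {r : ℕ} {n : Fin r → ℕ}
    (F : CoordRing k n) (P : Space k n) : Prop :=
  MvPolynomial.eval (fun v : Var n => (P v.1).rep v.2) F = 0

/-- `I_X`: the ideal generated by all multihomogeneous forms that vanish at all points of `X`. -/
noncomputable def vanishingIdeal {k : Type*} [Field k] {r : ℕ} {n : Fin r → ℕ}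
    (X : Finset (Space k n)) : Ideal (CoordRing k n) :=
  Ideal.span {F | (∃ d, F ∈ forms k n d) ∧ ∀ P ∈ X, VanishesAt F P}

/-- The graded piece `S_d` of `S = R / I`, for a multihomogeneous ideal `I`: the classes of
the forms of multidegree `d`. -/
noncomputable def quotientPiece {k : Type*} [Field k] {r : ℕ} {n : Fin r → ℕ}
    (I : Ideal (CoordRing k n)) (d : Fin r → ℕ) : Submodule k (CoordRing k n ⧸ I) :=
  (forms k n d).map (Ideal.Quotient.mkₐ k I).toLinearMap

/-- The Hilbert function `H_X(d) = dim_k (R / I_X)_d` of a finite set of points. -/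
noncomputable def hilbertFunction {k : Type*} [Field k] {r : ℕ} {n : Fin r → ℕ}
    (X : Finset (Space k n)) (d : Fin r → ℕ) : ℕ :=
  Module.finrank k (quotientPiece (vanishingIdeal X) d)

/-- The ideal `𝔪 = (x_{i,j})` of the coordinate ring. -/
noncomputable def irrelevantIdeal (k : Type*) [Field k] {r : ℕ} (n : Fin r → ℕ) : Ideal (CoordRing k n) :=
  Ideal.span (Set.range MvPolynomial.X)

open Classical in
/-- The depth of the module `M` in the ideal `I`: the supremum of the lengths of the `M`-regular
sequences of elements of `I` if `I M ≠ M`, and `∞` if `I M = M`. -/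
noncomputable def idealDepth {A : Type*} [CommRing A] (I : Ideal A)
    (M : Type*) [AddCommGroup M] [Module A M] : ℕ∞ :=
  if I • (⊤ : Submodule A M) = ⊤ then ⊤
  else ⨆ (s : List A) (_ : (∀ a ∈ s, a ∈ I) ∧ RingTheory.Sequence.IsRegular M s),
    (s.length : ℕ∞)

/-- `X` is arithmetically Cohen-Macaulay: `dim R / I_X = depth R / I_X = r`, where the depth of
the graded ring `R / I_X` is taken in the ideal generated by the variables. -/
def IsACM {k : Type*} [Field k] {r : ℕ} {n : Fin r → ℕ} (X : Finset (Space k n)) : Prop :=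
  ringKrullDim (CoordRing k n ⧸ vanishingIdeal X) = r ∧
    idealDepth (irrelevantIdeal k n) (CoordRing k n ⧸ vanishingIdeal X) = r

end Multiprojective

/-! Suppose the depth is r and forms separate the points of X in degrees i and j. Let m be the
componentwise minimum and f any function on X. Choose linear forms L_t of degree e_t with no zero on
X, and let c, d be the products of their powers of degrees i - m and j - m. There are forms u, v of
degrees i, j with values c f and d f on X, so d u = c v in R/I_X. If c divides u there, the quotient
has values f, so f is interpolated in degree m. Otherwise d kills the nonzero class of u modulo c,
so c and d lie in an associated prime P of the quotient by c. Since c is regular, that quotient has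
depth at least r - 1, and depth is bounded by the dimension of every associated prime, so dim of the
quotient by P is at least r - 1 (`exists_isPrime_of_mul_eq_mul`). But P contains some L_p with i_p >
j_p and some L_q with j_q > i_q. Here p ≠ q, and the L_t cut out only the vertex of the multicone,
so the dimension is at most r - 2 (`ringKrullDim_quotient_le_of_germ_mem`), a contradiction. The
depth argument is carried out in the local ring at the vertex, because Nakayama and the Ext
criterion for depth need a local ring and a regular sequence of elements of the irrelevant ideal
need not be homogeneous. `exists_form_of_germ_dvd` brings divisibility back to forms. -/

open RingTheory.Sequence IsLocalRing CategoryTheory Abelian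
open scoped Pointwise

/-! ### Depth, associated primes and dimension in Noetherian local rings. -/

/-- A weakly regular sequence in the maximal ideal is no longer than the dimension of any associated
prime of the module. -/
theorem RingTheory.Sequence.IsWeaklyRegular.length_le_ringKrullDim_quotient
    {B : Type*} [CommRing B] [IsLocalRing B] [IsNoetherianRing B]
    {M : Type*} [AddCommGroup M] [Module B M] [Module.Finite B M] {rs : List B}
    (hreg : IsWeaklyRegular M rs) (hmem : ∀ y ∈ rs, y ∈ maximalIdeal B)
    {P : Ideal B} (hP : IsAssociatedPrime P M) :
    (rs.length : WithBot ℕ∞) ≤ ringKrullDim (B ⧸ P) := by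
  induction rs generalizing M P with
  | nil =>
    have := hP.isPrime
    simpa using ringKrullDim_nonneg_of_nontrivial (R := B ⧸ P)
  | cons y rs ih =>
    have hPp := hP.isPrime
    obtain ⟨hy, hrs⟩ := (isWeaklyRegular_cons_iff M y rs).mp hreg
    obtain ⟨x, hx⟩ := (isAssociatedPrime_iff.mp hP).2
    have hmemP : ∀ p, p ∈ P ↔ p • x = 0 := fun p => by
      rw [hx, Submodule.mem_colon_singleton, Submodule.mem_bot]
    have hx0 : x ≠ 0 := fun h => hPp.ne_top <| (Ideal.eq_top_iff_one P).mpr <| by simp [hmemP, h]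
    have hyP : y ∉ P := fun h => hx0 <| hy <| by simpa using (hmemP y).mp h
    -- Let K be the submodule killed by P. If K ⊆ yM, then regularity of y gives K = yK, so K = 0 by
    -- Nakayama, although x ∈ K.
    obtain ⟨w, hwP, hw⟩ : ∃ w : M, (∀ p ∈ P, p • w = 0) ∧ w ∉ y • (⊤ : Submodule B M) := by
      by_contra! hcon
      let K : Submodule B M :=
        { carrier := {w | ∀ p ∈ P, p • w = 0}
          add_mem' := fun ha hb p hp => by rw [smul_add, ha p hp, hb p hp, add_zero]
          zero_mem' := fun p _ => smul_zero p
          smul_mem' := fun c w hw p hp => by rw [smul_comm, hw p hp, smul_zero] }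
      have hK : K ≤ Ideal.span {y} • K := by
        intro w hw
        obtain ⟨w', -, rfl⟩ := Submodule.mem_smul_pointwise_iff_exists _ _ _ |>.mp (hcon w hw)
        refine Submodule.smul_mem_smul (Ideal.mem_span_singleton_self y) fun p hp => hy ?_
        beta_reduce
        rw [smul_zero, smul_comm, hw p hp]
      have := Submodule.eq_bot_of_le_smul_of_le_jacobson_bot (Ideal.span {y}) K
        (IsNoetherian.noetherian K) hK
        ((Ideal.span_singleton_le_iff_mem _).mpr
          (maximalIdeal_le_jacobson _ (hmem y List.mem_cons_self)))
      exact hx0 <| (Submodule.mem_bot B).mp <| this ▸ show x ∈ K from fun p hp => (hmemP p).mp hp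
    -- The annihilator of the class of w contains P and y, and y ∉ P, so an associated prime Q of
    -- M/yM above it is strictly larger than P.
    obtain ⟨Q, hQ, hle⟩ := exists_le_isAssociatedPrime_of_isNoetherianRing B
      (Submodule.Quotient.mk w : QuotSMulTop y M)
      (fun h => hw ((Submodule.Quotient.mk_eq_zero _).mp h))
    have hQp := hQ.isPrime
    have hPQ : P < Q := by
      refine lt_of_le_of_ne (fun p hp => hle ?_) fun h => hyP (h ▸ hle ?_)
      · rw [Submodule.mem_colon_singleton, ← Submodule.Quotient.mk_smul, hwP p hp]; simp
      · rw [Submodule.mem_colon_singleton, ← Submodule.Quotient.mk_smul, Submodule.mem_bot,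
          Submodule.Quotient.mk_eq_zero]
        exact Submodule.smul_mem_pointwise_smul _ _ _ trivial
    have h1 := ih hrs (fun z hz => hmem z (List.mem_cons_of_mem _ hz)) hQ
    -- An element of Q outside P is a nonzerodivisor of the domain B/P, so dividing by it lowers the
    -- dimension by at least one.
    have h2 : ringKrullDim (B ⧸ Q) + 1 ≤ ringKrullDim (B ⧸ P) := by
      obtain ⟨z, hzQ, hzP⟩ := Set.exists_of_ssubset hPQ
      have hz : Ideal.Quotient.mk P z ∈ nonZeroDivisors (B ⧸ P) :=
        mem_nonZeroDivisors_of_ne_zero fun h => hzP (Ideal.Quotient.eq_zero_iff_mem.mp h)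
      refine le_trans ?_ (ringKrullDim_quotient_succ_le_of_nonZeroDivisor hz)
      gcongr
      refine ringKrullDim_le_of_surjective (Ideal.Quotient.lift _
        (Ideal.Quotient.factor hPQ.le) ?_) ?_
      · intro a ha
        have : Ideal.span {Ideal.Quotient.mk P z} ≤ RingHom.ker (Ideal.Quotient.factor hPQ.le) := by
          rw [Ideal.span_singleton_le_iff_mem, RingHom.mem_ker, Ideal.Quotient.factor_mk]
          exact Ideal.Quotient.eq_zero_iff_mem.mpr hzQ
        exact this ha
      · exact Ideal.Quotient.lift_surjective_of_surjective _ _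
          (Ideal.Quotient.factor_surjective hPQ.le)
    refine le_trans ?_ h2
    push_cast [List.length_cons]
    gcongr

/-- Modulo a regular element of a local ring the depth drops by at most one. -/
theorem exists_isRegular_quotSMulTop {B : Type*} [CommRing B] [IsLocalRing B] [IsNoetherianRing B]
    {rs : List B} (hreg : IsRegular B rs) (hmem : ∀ y ∈ rs, y ∈ maximalIdeal B)
    {c : B} (hc : c ∈ maximalIdeal B) (hcreg : IsSMulRegular B c) :
    ∃ ts : List B, ts.length = rs.length - 1 ∧ (∀ y ∈ ts, y ∈ maximalIdeal B) ∧
      IsRegular (QuotSMulTop c B) ts := by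
  have hlt : ∀ (M : Type _) [AddCommGroup M] [Module B M] [Module.Finite B M] [Nontrivial M],
      maximalIdeal B • (⊤ : Submodule B M) < ⊤ := fun M _ _ _ _ =>
    (Submodule.top_ne_ideal_smul_of_le_jacobson_annihilator
      (maximalIdeal_le_jacobson _)).symm.lt_top
  -- Rees: a regular sequence of length n exists iff the groups Ext^i into the module vanish for i <
  -- n. In the long exact sequence of 0 → B → B → B/c → 0, Ext^i into B/c lies between Ext^i and
  -- Ext^(i+1) into B, which costs one degree.
  have hiff := (ModuleCat.exists_isRegular_tfae (maximalIdeal B) rs.length (ModuleCat.of B B)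
    (hlt B)).out 1 3
  have hB := hiff.mpr ⟨rs, rfl, hmem, hreg⟩
  have : Nontrivial (QuotSMulTop c B) := nontrivial_quotSMulTop_of_mem_maximalIdeal B hc
  refine ((ModuleCat.exists_isRegular_tfae (maximalIdeal B) (rs.length - 1)
    (ModuleCat.of B (QuotSMulTop c B)) (hlt _)).out 1 3).mp fun i hi => ?_
  have zero1 := AddCommGrpCat.isZero_of_iff_subsingleton.mpr (hB i (by omega))
  have zero2 := AddCommGrpCat.isZero_of_iff_subsingleton.mpr (hB (i + 1) (by omega))
  exact AddCommGrpCat.subsingleton_of_isZero <| ShortComplex.Exact.isZero_of_both_zeros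
    (Ext.covariant_sequence_exact₃' _
      (IsSMulRegular.smulShortComplex_shortExact (M := ModuleCat.of B B) hcreg) i (i + 1) rfl)
    (zero1.eq_zero_of_src _) (zero2.eq_zero_of_tgt _)

/-- If `d u ∈ (c)` but `u ∉ (c)`, with `c` regular in a local ring, then `c` and `d` lie in a prime
whose dimension is at least the depth minus one. -/
theorem exists_isPrime_of_mul_eq_mul {B : Type*} [CommRing B] [IsLocalRing B] [IsNoetherianRing B]
    {rs : List B} (hreg : IsRegular B rs) (hmem : ∀ y ∈ rs, y ∈ maximalIdeal B)
    {c d u v : B} (hc : c ∈ maximalIdeal B) (hcreg : IsSMulRegular B c)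
    (huv : d * u = c * v) (hu : ¬ c ∣ u) :
    ∃ P : Ideal B, P.IsPrime ∧ c ∈ P ∧ d ∈ P ∧
      (rs.length : WithBot ℕ∞) ≤ ringKrullDim (B ⧸ P) + 1 := by
  obtain ⟨ts, hlen, htmem, hts⟩ := exists_isRegular_quotSMulTop hreg hmem hc hcreg
  have hdvd : ∀ z : B, (Submodule.Quotient.mk z : QuotSMulTop c B) = 0 ↔ c ∣ z := fun z => by
    rw [Submodule.Quotient.mk_eq_zero, Submodule.mem_smul_pointwise_iff_exists]
    simp [dvd_def, eq_comm]
  -- P is an associated prime of B/c above the annihilator of the class of u, which contains c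
  -- trivially and d because d u = c v.
  obtain ⟨P, hP, hle⟩ := exists_le_isAssociatedPrime_of_isNoetherianRing B
    (Submodule.Quotient.mk u : QuotSMulTop c B) (fun h => hu ((hdvd u).mp h))
  have hcolon : ∀ z, c ∣ z * u → z ∈ P := fun z hz => hle <| by
    rw [Submodule.mem_colon_singleton, ← Submodule.Quotient.mk_smul, Submodule.mem_bot, hdvd]
    exact hz
  refine ⟨P, hP.isPrime, hcolon c (dvd_mul_right _ _), hcolon d ⟨v, huv⟩, ?_⟩
  have := hts.toIsWeaklyRegular.length_le_ringKrullDim_quotient htmem hP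
  calc (rs.length : WithBot ℕ∞) ≤ ((ts.length + 1 : ℕ) : WithBot ℕ∞) := by
        exact_mod_cast (by omega : rs.length ≤ ts.length + 1)
    _ ≤ _ := by push_cast; gcongr

/-- The number of elements generating an ideal primary to the maximal ideal bounds the dimension. -/
theorem ringKrullDim_le_card_of_isPrime_eq_maximalIdeal {D : Type*} [CommRing D] [IsLocalRing D]
    [IsNoetherianRing D] (s : Finset D) (hs : (s : Set D) ⊆ maximalIdeal D)
    (h : ∀ Q : Ideal D, Q.IsPrime → (s : Set D) ⊆ Q → maximalIdeal D ≤ Q) :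
    ringKrullDim D ≤ s.card := by
  rw [← maximalIdeal_height_eq_ringKrullDim]
  have : maximalIdeal D ∈ (Ideal.span (s : Set D)).minimalPrimes :=
    ⟨⟨inferInstance, Ideal.span_le.mpr hs⟩,
      fun Q hQ _ => h Q hQ.1 (Ideal.span_le.mp hQ.2)⟩
  exact_mod_cast Ideal.height_le_card_of_mem_minimalPrimes_span_finset this

/-! ### Restriction of polynomials to the multicone over a point. -/

namespace Multiprojective

open MvPolynomial

variable {k : Type*} [Field k] {r : ℕ} {n : Fin r → ℕ}

/-- The homomorphism `x_{i,j} ↦ P_{i,j} T_i` to `k[T_1, …, T_r]`, which restricts functions to the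
multicone over the point `P`. -/
noncomputable def coneEval (P : Space k n) : CoordRing k n →ₐ[k] MvPolynomial (Fin r) k :=
  aeval fun v : Var n => C ((P v.1).rep v.2) * X v.1

theorem weight_varDegree (m : Var n →₀ ℕ) :
    Finsupp.weight (varDegree n) m = ∑ v, m v • (Pi.single v.1 1 : Fin r → ℕ) := by
  rw [Finsupp.weight_apply, Finsupp.sum_fintype _ _ (by simp)]
  rfl

theorem coneEval_monomial (P : Space k n) (m : Var n →₀ ℕ) (a : k) :
    coneEval P (monomial m a) =
      monomial (Finsupp.equivFunOnFinite.symm (Finsupp.weight (varDegree n) m))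
        (eval (fun v : Var n => (P v.1).rep v.2) (monomial m a)) := by
  have hX : ∀ e : Fin r → ℕ, ∏ t, (X t : MvPolynomial (Fin r) k) ^ e t =
      monomial (Finsupp.equivFunOnFinite.symm e) 1 := fun e => by
    rw [monomial_eq, Finsupp.prod_fintype _ _ (by simp)]
    simp
  have hprod : ∏ v : Var n, (X v.1 : MvPolynomial (Fin r) k) ^ m v =
      ∏ t, X t ^ (Finsupp.weight (varDegree n) m t) := by
    rw [weight_varDegree]
    simp_rw [Finset.sum_apply, ← Finset.prod_pow_eq_pow_sum]
    rw [Finset.prod_comm]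
    refine Finset.prod_congr rfl fun v _ => ?_
    rw [Finset.prod_eq_single v.1 (fun t _ ht => by simp [Pi.single_eq_of_ne ht]) (by simp)]
    simp
  rw [coneEval, aeval_monomial, eval_monomial, Finsupp.prod_fintype _ _ (by simp),
    Finsupp.prod_fintype _ _ (by simp)]
  simp_rw [mul_pow, Finset.prod_mul_distrib]
  rw [hprod, hX, ← mul_assoc, algebraMap_eq]
  simp_rw [← C_pow]
  rw [← map_prod, ← C_mul, C_mul_monomial, mul_one]

theorem coneEval_of_mem_forms (P : Space k n) {F : CoordRing k n} {d : Fin r → ℕ}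
    (hF : F ∈ forms k n d) :
    coneEval P F = monomial (Finsupp.equivFunOnFinite.symm d)
      (eval (fun v : Var n => (P v.1).rep v.2) F) := by
  conv_lhs => rw [F.as_sum]
  conv_rhs => rw [F.as_sum]
  rw [map_sum, map_sum, map_sum]
  refine Finset.sum_congr rfl fun m hm => ?_
  rw [coneEval_monomial, hF (mem_support_iff.mp hm)]

/-- The variables T_i record the multidegree, so distinct multihomogeneous components of F cannot
cancel on the cone. -/
theorem coeff_coneEval (P : Space k n) (F : CoordRing k n) (d : Fin r → ℕ) :
    coeff (Finsupp.equivFunOnFinite.symm d) (coneEval P F) =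
      eval (fun v : Var n => (P v.1).rep v.2)
        (weightedHomogeneousComponent (varDegree n) d F) := by
  induction F using MvPolynomial.induction_on' with
  | add p q hp hq => simp only [map_add, coeff_add, hp, hq]
  | monomial m a =>
    rw [coneEval_monomial, coeff_monomial,
      weightedHomogeneousComponent_of_mem (isWeightedHomogeneous_monomial _ m a rfl)]
    simp only [EmbeddingLike.apply_eq_iff_eq, eq_comm (a := d)]
    split_ifs <;> simp

theorem mem_vanishingIdeal_of_mem_forms {X : Finset (Space k n)} {F : CoordRing k n}
    {d : Fin r → ℕ} (hF : F ∈ forms k n d)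
    (h : ∀ P ∈ X, eval (fun v : Var n => (P v.1).rep v.2) F = 0) : F ∈ vanishingIdeal X :=
  Ideal.subset_span ⟨⟨d, hF⟩, h⟩

/-- This makes I_X an intersection of kernels of maps to the domain k[T_1, …, T_r], so membership
can be tested on inhomogeneous elements too. -/
theorem mem_vanishingIdeal_iff {X : Finset (Space k n)} {F : CoordRing k n} :
    F ∈ vanishingIdeal X ↔ ∀ P ∈ X, coneEval P F = 0 := by
  constructor
  · intro hF P hP
    have : vanishingIdeal X ≤ RingHom.ker (coneEval P) := by
      refine Ideal.span_le.mpr ?_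
      rintro G ⟨⟨d, hd⟩, hG⟩
      have hGP : eval (fun v : Var n => (P v.1).rep v.2) G = 0 := hG P hP
      show coneEval P G = 0
      rw [coneEval_of_mem_forms P hd, hGP, map_zero]
    exact this hF
  · intro h
    rw [← finsum_weightedHomogeneousComponent (varDegree n) F]
    refine finsum_induction (· ∈ vanishingIdeal X) (zero_mem _)
      (fun _ _ => add_mem) fun d => ?_
    refine mem_vanishingIdeal_of_mem_forms (weightedHomogeneousComponent_mem _ F d) fun P hP => ?_
    rw [← coeff_coneEval, h P hP, coeff_zero]

theorem eval_eq_zero_of_mem_vanishingIdeal {X : Finset (Space k n)} {F : CoordRing k n}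
    {d : Fin r → ℕ} (hd : F ∈ forms k n d) (hF : F ∈ vanishingIdeal X) {P : Space k n}
    (hP : P ∈ X) : eval (fun v : Var n => (P v.1).rep v.2) F = 0 := by
  have := mem_vanishingIdeal_iff.mp hF P hP
  rwa [coneEval_of_mem_forms P hd, monomial_eq_zero] at this

/-! ### Interpolation on X and linear forms without zeros on X. -/

/-- The evaluation of the forms of multidegree `d` at the points of `X`. -/
noncomputable def evalForms (X : Finset (Space k n)) (d : Fin r → ℕ) :
    forms k n d →ₗ[k] (X → k) :=
  LinearMap.pi fun P =>
    (aeval (R := k) fun v : Var n => (P.1 v.1).rep v.2).toLinearMap ∘ₗ (forms k n d).subtype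

theorem evalForms_apply (X : Finset (Space k n)) (d : Fin r → ℕ) (F : forms k n d) (P : X) :
    evalForms X d F P = eval (fun v : Var n => (P.1 v.1).rep v.2) F.1 := by
  simp [evalForms, aeval_eq_eval]

/-- The forms of degree d lying in I_X are exactly the kernel of evaluation on X. -/
theorem hilbertFunction_eq_finrank_range (X : Finset (Space k n)) (d : Fin r → ℕ) :
    hilbertFunction X d = Module.finrank k (LinearMap.range (evalForms X d)) := by
  let f := (Ideal.Quotient.mkₐ k (vanishingIdeal X)).toLinearMap.domRestrict (forms k n d)
  have hf : quotientPiece (vanishingIdeal X) d = LinearMap.range f :=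
    (LinearMap.range_domRestrict _ _).symm
  have hker : LinearMap.ker f = LinearMap.ker (evalForms X d) := by
    ext F
    have h1 : F ∈ LinearMap.ker f ↔ F.1 ∈ vanishingIdeal X := Ideal.Quotient.eq_zero_iff_mem
    rw [h1, LinearMap.mem_ker]
    constructor
    · intro h
      funext P
      rw [evalForms_apply]
      exact eval_eq_zero_of_mem_vanishingIdeal F.2 h P.2
    · intro h
      refine mem_vanishingIdeal_of_mem_forms F.2 fun P hP => ?_
      rw [← evalForms_apply X d F ⟨P, hP⟩, h, Pi.zero_apply]
  rw [hilbertFunction, hf, ← f.quotKerEquivRange.finrank_eq, hker,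
    (evalForms X d).quotKerEquivRange.finrank_eq]

theorem hilbertFunction_eq_card_iff (X : Finset (Space k n)) (d : Fin r → ℕ) :
    hilbertFunction X d = X.card ↔ Function.Surjective (evalForms X d) := by
  rw [hilbertFunction_eq_finrank_range, ← LinearMap.range_eq_top]
  constructor
  · intro h
    exact Submodule.eq_top_of_finrank_eq (by simp [h])
  · intro h
    rw [h, finrank_top]
    simp

/-- Each point excludes a proper subspace of the dual of k^(n_t+1), and finitely many of these do
not cover it when k is infinite. -/
theorem exists_linearForm_eval_ne_zero [Infinite k] (X : Finset (Space k n)) (t : Fin r) :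
    ∃ L ∈ forms k n (Pi.single t 1),
      ∀ P ∈ X, eval (fun v : Var n => (P v.1).rep v.2) L ≠ 0 := by
  obtain ⟨f, hf⟩ := Module.exists_dual_forall_apply_ne_zero (K := k)
    (fun P : X => (P.1 t).rep) fun P => (P.1 t).rep_nonzero
  refine ⟨∑ j, C (f (Pi.single j 1)) * MvPolynomial.X ⟨t, j⟩, ?_, fun P hP => ?_⟩
  · exact Submodule.sum_mem _ fun j _ =>
      (isWeightedHomogeneous_X k (varDegree n) ⟨t, j⟩).C_mul _
  · suffices h : eval (fun v : Var n => (P v.1).rep v.2)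
        (∑ j, C (f (Pi.single j 1)) * MvPolynomial.X ⟨t, j⟩) = f (P t).rep from h ▸ hf ⟨P, hP⟩
    conv_rhs => rw [← Finset.univ_sum_single (P t).rep, map_sum]
    rw [map_sum]
    refine Finset.sum_congr rfl fun j _ => ?_
    have : (Pi.single j ((P t).rep j) : Fin (n t + 1) → k) = (P t).rep j • Pi.single j 1 := by
      rw [← Pi.single_smul, smul_eq_mul, mul_one]
    rw [this, map_smul, map_mul, eval_C, eval_X, smul_eq_mul, mul_comm]

theorem prod_pow_mem_forms {L : Fin r → CoordRing k n} (hL : ∀ t, L t ∈ forms k n (Pi.single t 1))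
    (a : Fin r → ℕ) : ∏ t, L t ^ a t ∈ forms k n a := by
  have := IsWeightedHomogeneous.prod Finset.univ (fun t => L t ^ a t)
    (fun t => a t • (Pi.single t 1 : Fin r → ℕ)) fun t _ => IsWeightedHomogeneous.pow (hL t) (a t)
  have hsum : ∑ t, a t • (Pi.single t 1 : Fin r → ℕ) = a := by
    ext t
    simp [Finset.sum_apply, Pi.single_apply]
  rwa [hsum] at this

/-- A prime over `I_X` which contains a linear form of degree `e_t` not vanishing on `X` contains
all the variables of degree `e_t`. -/
theorem X_mem_of_linearForm_mem {X : Finset (Space k n)} {t : Fin r} {L : CoordRing k n}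
    (hL : L ∈ forms k n (Pi.single t 1))
    (hLX : ∀ P ∈ X, eval (fun v : Var n => (P v.1).rep v.2) L ≠ 0)
    {Q : Ideal (CoordRing k n)} [Q.IsPrime] (hQ : vanishingIdeal X ≤ Q) (hLQ : L ∈ Q)
    (j : Fin (n t + 1)) : (MvPolynomial.X ⟨t, j⟩ : CoordRing k n) ∈ Q := by
  let ev (P : Space k n) := eval (fun v : Var n => (P v.1).rep v.2)
  -- This linear form vanishes at P, so the product over X lies in I_X ⊆ Q and some factor lies in
  -- Q. Modulo L ∈ Q that factor is a nonzero multiple of x_{t,j}.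
  let l (P : Space k n) : CoordRing k n := C (ev P L) * MvPolynomial.X ⟨t, j⟩ - C ((P t).rep j) * L
  have hl : ∀ P, l P ∈ forms k n (Pi.single t 1) := fun P =>
    Submodule.sub_mem _ ((isWeightedHomogeneous_X k (varDegree n) ⟨t, j⟩).C_mul _)
      (IsWeightedHomogeneous.C_mul hL _)
  have hmem : ∏ P ∈ X, l P ∈ vanishingIdeal X := by
    refine mem_vanishingIdeal_of_mem_forms
      (IsWeightedHomogeneous.prod X l _ fun P _ => hl P) fun P hP => ?_
    rw [map_prod]
    refine Finset.prod_eq_zero hP ?_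
    simp only [l, ev, map_sub, map_mul, eval_C, eval_X]
    ring
  obtain ⟨P, hP, hPQ⟩ := (Ideal.IsPrime.prod_mem_iff).mp (hQ hmem)
  have h1 : C (ev P L) * MvPolynomial.X ⟨t, j⟩ ∈ Q := by
    have := Q.add_mem hPQ (Q.mul_mem_left (C ((P t).rep j)) hLQ)
    rwa [sub_add_cancel] at this
  have h2 := Q.mul_mem_left (C (ev P L)⁻¹) h1
  rwa [← mul_assoc, ← C_mul, inv_mul_cancel₀ (hLX P hP), C_1, one_mul] at h2

/-! ### Constant terms, and regular sequences from depth. -/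

theorem constantCoeff_eq_zero_of_mem_irrelevantIdeal {F : CoordRing k n}
    (hF : F ∈ irrelevantIdeal k n) : constantCoeff F = 0 := by
  have : irrelevantIdeal k n ≤ RingHom.ker (constantCoeff (σ := Var n) (R := k)) := by
    refine Ideal.span_le.mpr ?_
    rintro _ ⟨v, rfl⟩
    simp
  exact this hF

theorem mem_of_constantCoeff_eq_zero {F : CoordRing k n} (hF : constantCoeff F = 0)
    {Q : Ideal (CoordRing k n)} (hQ : ∀ v, (X v : CoordRing k n) ∈ Q) : F ∈ Q := by
  rw [F.as_sum]
  refine Q.sum_mem fun m hm => ?_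
  have hm0 : m ≠ 0 := by
    rintro rfl
    exact mem_support_iff.mp hm hF
  obtain ⟨v, hv⟩ := Finsupp.ne_iff.mp hm0
  exact Q.mem_of_dvd (X_dvd_monomial.mpr (Or.inr hv)) (hQ v)

theorem constantCoeff_coneEval (P : Space k n) (F : CoordRing k n) :
    constantCoeff (coneEval P F) = constantCoeff F := by
  induction F using MvPolynomial.induction_on with
  | C a => simp [coneEval]
  | add p q hp hq => simp only [map_add, hp, hq]
  | mul_X p v hp => simp [coneEval, map_mul]

/-- A finite value rules out the case IM = M, and a supremum equal to r > 0 is not bounded by r - 1.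
-/
theorem exists_isWeaklyRegular_of_idealDepth_eq {A : Type*} [CommRing A] {I : Ideal A}
    {M : Type*} [AddCommGroup M] [Module A M] {r : ℕ} (h : idealDepth I M = r) (hr : r ≠ 0) :
    ∃ s : List A, (∀ a ∈ s, a ∈ I) ∧ RingTheory.Sequence.IsWeaklyRegular M s ∧ r ≤ s.length := by
  rw [idealDepth] at h
  split_ifs at h with htop
  · exact absurd h.symm (ENat.natCast_ne_top r)
  · have hlt : ((r - 1 : ℕ) : ℕ∞) <
        ⨆ (s : List A) (_ : (∀ a ∈ s, a ∈ I) ∧ RingTheory.Sequence.IsRegular M s),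
          (s.length : ℕ∞) := by
      rw [h]
      exact_mod_cast (by omega : r - 1 < r)
    simp only [lt_iSup_iff] at hlt
    obtain ⟨s, ⟨hs, hreg⟩, hlen⟩ := hlt
    refine ⟨s, hs, hreg.toIsWeaklyRegular, ?_⟩
    have : r - 1 < s.length := by exact_mod_cast hlen
    omega

end Multiprojective

/-! ### The local ring of the multicone at its vertex. -/

namespace Multiprojective

open MvPolynomial IsLocalRing RingTheory.Sequence

variable {k : Type*} [Field k] {r : ℕ} {n : Fin r → ℕ}

/-- On the cone over each point of X such a form is a nonzero monomial in a domain. -/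
theorem isSMulRegular_of_mem_forms {X : Finset (Space k n)} {F : CoordRing k n} {d : Fin r → ℕ}
    (hF : F ∈ forms k n d) (hFX : ∀ P ∈ X, eval (fun v : Var n => (P v.1).rep v.2) F ≠ 0) :
    IsSMulRegular (CoordRing k n ⧸ vanishingIdeal X) (Ideal.Quotient.mk (vanishingIdeal X) F) := by
  refine isSMulRegular_iff_right_eq_zero_of_smul.mpr fun x hx => ?_
  obtain ⟨G, rfl⟩ := Ideal.Quotient.mk_surjective x
  rw [smul_eq_mul, ← map_mul, Ideal.Quotient.eq_zero_iff_mem, mem_vanishingIdeal_iff] at hx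
  refine Ideal.Quotient.eq_zero_iff_mem.mpr (mem_vanishingIdeal_iff.mpr fun P hP => ?_)
  have h := hx P hP
  rw [map_mul, coneEval_of_mem_forms P hF] at h
  exact (mul_eq_zero.mp h).resolve_left fun h0 => hFX P hP (monomial_eq_zero.mp h0)

theorem constantCoeff_eq_zero_of_mem_vanishingIdeal {X : Finset (Space k n)} (hX : X.Nonempty)
    {F : CoordRing k n} (hF : F ∈ vanishingIdeal X) : constantCoeff F = 0 := by
  obtain ⟨P, hP⟩ := hX
  rw [← constantCoeff_coneEval P, mem_vanishingIdeal_iff.mp hF P hP, map_zero]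

/-- The value at the vertex, as a function on the multicone over `X`. -/
noncomputable def vertexEval {X : Finset (Space k n)} (hX : X.Nonempty) :
    CoordRing k n ⧸ vanishingIdeal X →+* k :=
  Ideal.Quotient.lift _ constantCoeff fun _ => constantCoeff_eq_zero_of_mem_vanishingIdeal hX

instance isPrime_ker_vertexEval {X : Finset (Space k n)} (hX : X.Nonempty) :
    (RingHom.ker (vertexEval hX)).IsPrime :=
  RingHom.ker_isPrime _

/-- The local ring of the multicone over `X` at its vertex. -/
def VertexLocalRing {X : Finset (Space k n)} (hX : X.Nonempty) : Type _ :=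
  Localization.AtPrime (RingHom.ker (vertexEval hX))

noncomputable instance {X : Finset (Space k n)} (hX : X.Nonempty) :
    CommRing (VertexLocalRing hX) :=
  inferInstanceAs (CommRing (Localization.AtPrime (RingHom.ker (vertexEval hX))))

noncomputable instance {X : Finset (Space k n)} (hX : X.Nonempty) :
    Algebra (CoordRing k n ⧸ vanishingIdeal X) (VertexLocalRing hX) :=
  inferInstanceAs (Algebra _ (Localization.AtPrime (RingHom.ker (vertexEval hX))))

instance {X : Finset (Space k n)} (hX : X.Nonempty) :
    IsLocalization.AtPrime (VertexLocalRing hX) (RingHom.ker (vertexEval hX)) :=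
  inferInstanceAs (IsLocalization.AtPrime (Localization.AtPrime (RingHom.ker (vertexEval hX)))
    (RingHom.ker (vertexEval hX)))

instance {X : Finset (Space k n)} (hX : X.Nonempty) : IsLocalRing (VertexLocalRing hX) :=
  IsLocalization.AtPrime.isLocalRing _ (RingHom.ker (vertexEval hX))

instance {X : Finset (Space k n)} (hX : X.Nonempty) : IsNoetherianRing (VertexLocalRing hX) :=
  IsLocalization.isNoetherianRing (RingHom.ker (vertexEval hX)).primeCompl _ inferInstance

/-- The germ of a polynomial at the vertex of the multicone over `X`. -/
noncomputable def germ {X : Finset (Space k n)} (hX : X.Nonempty) :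
    CoordRing k n →+* VertexLocalRing hX :=
  (algebraMap (CoordRing k n ⧸ vanishingIdeal X) _).comp (Ideal.Quotient.mk (vanishingIdeal X))

section VertexLocalRing

variable {X : Finset (Space k n)} (hX : X.Nonempty)

theorem germ_mem_maximalIdeal_iff {F : CoordRing k n} :
    germ hX F ∈ maximalIdeal (VertexLocalRing hX) ↔ constantCoeff F = 0 :=
  IsLocalization.AtPrime.to_map_mem_maximal_iff (VertexLocalRing hX)
    (RingHom.ker (vertexEval hX)) (Ideal.Quotient.mk (vanishingIdeal X) F)

theorem germ_eq_zero_of_mem {F : CoordRing k n} (hF : F ∈ vanishingIdeal X) :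
    germ hX F = 0 := by
  rw [germ, RingHom.comp_apply, Ideal.Quotient.eq_zero_iff_mem.mpr hF, map_zero]

theorem exists_mul_germ_eq (z : VertexLocalRing hX) :
    ∃ F G : CoordRing k n, constantCoeff G ≠ 0 ∧ z * germ hX G = germ hX F := by
  obtain ⟨⟨x, y⟩, h⟩ := IsLocalization.surj (RingHom.ker (vertexEval hX)).primeCompl z
  obtain ⟨F, rfl⟩ := Ideal.Quotient.mk_surjective x
  obtain ⟨y, hy⟩ := y
  obtain ⟨G, rfl⟩ := Ideal.Quotient.mk_surjective y
  exact ⟨F, G, hy, h⟩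

theorem exists_mul_mem_of_germ_eq_zero {F : CoordRing k n} (h : germ hX F = 0) :
    ∃ G : CoordRing k n, constantCoeff G ≠ 0 ∧ G * F ∈ vanishingIdeal X := by
  obtain ⟨⟨y, hy⟩, h⟩ := (IsLocalization.map_eq_zero_iff
    (RingHom.ker (vertexEval hX)).primeCompl (VertexLocalRing hX) _).mp h
  obtain ⟨G, rfl⟩ := Ideal.Quotient.mk_surjective y
  exact ⟨G, hy, Ideal.Quotient.eq_zero_iff_mem.mp (by rw [map_mul]; exact h)⟩

theorem exists_mul_sub_mem_of_germ_dvd {F G : CoordRing k n} (h : germ hX F ∣ germ hX G) :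
    ∃ s w : CoordRing k n, constantCoeff s ≠ 0 ∧ s * G - F * w ∈ vanishingIdeal X := by
  obtain ⟨z, hz⟩ := h
  obtain ⟨w, s, hs, hsw⟩ := exists_mul_germ_eq hX z
  obtain ⟨t, ht, hmem⟩ := exists_mul_mem_of_germ_eq_zero hX (F := s * G - F * w) <| by
    rw [map_sub, map_mul, map_mul, hz, ← hsw]; ring
  refine ⟨t * s, t * w, by rw [map_mul]; exact mul_ne_zero ht hs, ?_⟩
  convert hmem using 1
  ring

/-- Weak regularity survives any localization. Full regularity then follows once the germs are known
to lie in the maximal ideal. -/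
theorem isWeaklyRegular_map_germ {s : List (CoordRing k n)}
    (hs : IsWeaklyRegular (CoordRing k n ⧸ vanishingIdeal X) s) :
    IsWeaklyRegular (VertexLocalRing hX) (s.map (germ hX)) := by
  have h1 := (isWeaklyRegular_map_algebraMap_iff (CoordRing k n ⧸ vanishingIdeal X)
    (CoordRing k n ⧸ vanishingIdeal X) s).mpr hs
  have h2 := h1.of_isLocalization (VertexLocalRing hX) (RingHom.ker (vertexEval hX)).primeCompl
  rwa [List.map_map] at h2

theorem isSMulRegular_germ {F : CoordRing k n} {d : Fin r → ℕ} (hF : F ∈ forms k n d)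
    (hFX : ∀ P ∈ X, eval (fun v : Var n => (P v.1).rep v.2) F ≠ 0) :
    IsSMulRegular (VertexLocalRing hX) (germ hX F) := by
  have h : IsWeaklyRegular (CoordRing k n ⧸ vanishingIdeal X)
      [Ideal.Quotient.mk (vanishingIdeal X) F] :=
    (isWeaklyRegular_singleton_iff _ _).mpr (isSMulRegular_of_mem_forms hF hFX)
  exact (isWeaklyRegular_singleton_iff _ _).mp
    (h.of_isLocalization (VertexLocalRing hX) (RingHom.ker (vertexEval hX)).primeCompl)

/-- A prime of the local ring at the vertex containing all the germs of linear forms of degrees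
`e_t` which do not vanish on `X` is the maximal ideal. -/
theorem maximalIdeal_le_of_germ_mem {L : Fin r → CoordRing k n}
    (hL : ∀ t, L t ∈ forms k n (Pi.single t 1))
    (hLX : ∀ t, ∀ P ∈ X, eval (fun v : Var n => (P v.1).rep v.2) (L t) ≠ 0)
    (Q : Ideal (VertexLocalRing hX)) [hQ : Q.IsPrime] (hLQ : ∀ t, germ hX (L t) ∈ Q) :
    maximalIdeal (VertexLocalRing hX) ≤ Q := by
  intro z hz
  obtain ⟨F, G, hG, h⟩ := exists_mul_germ_eq hX z
  have hF : constantCoeff F = 0 := by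
    rw [← germ_mem_maximalIdeal_iff hX, ← h]
    exact Ideal.mul_mem_right _ _ hz
  have hFQ : F ∈ Q.comap (germ hX) := mem_of_constantCoeff_eq_zero hF fun v =>
    X_mem_of_linearForm_mem (hL v.1) (hLX v.1)
      (fun H hH => by rw [Ideal.mem_comap, germ_eq_zero_of_mem hX hH]; exact Q.zero_mem)
      (hLQ v.1) v.2
  refine (hQ.mem_or_mem (h ▸ hFQ : z * germ hX G ∈ Q)).resolve_right fun hGQ => hG ?_
  exact (germ_mem_maximalIdeal_iff hX).mp (le_maximalIdeal hQ.ne_top hGQ)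

/-- Only the maximal ideal contains all r germs of the L_t. Two of them vanish modulo P, so the
remaining r - 2 cut out the closed point of the quotient, and Krull's height theorem applies. -/
theorem ringKrullDim_quotient_le_of_germ_mem {L : Fin r → CoordRing k n}
    (hL : ∀ t, L t ∈ forms k n (Pi.single t 1))
    (hLX : ∀ t, ∀ P ∈ X, eval (fun v : Var n => (P v.1).rep v.2) (L t) ≠ 0)
    (P : Ideal (VertexLocalRing hX)) [P.IsPrime] {p q : Fin r} (hpq : p ≠ q)
    (hp : germ hX (L p) ∈ P) (hq : germ hX (L q) ∈ P) :
    ringKrullDim (VertexLocalRing hX ⧸ P) ≤ (r - 2 : ℕ) := by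
  classical
  have : IsLocalRing (VertexLocalRing hX ⧸ P) :=
    .of_surjective' (Ideal.Quotient.mk P) Ideal.Quotient.mk_surjective
  have hcomap : (maximalIdeal (VertexLocalRing hX ⧸ P)).comap (Ideal.Quotient.mk P) =
      maximalIdeal (VertexLocalRing hX) :=
    eq_maximalIdeal (Ideal.comap_isMaximal_of_surjective _ Ideal.Quotient.mk_surjective)
  let s := ((Finset.univ.erase p).erase q).image fun t => Ideal.Quotient.mk P (germ hX (L t))
  have hconst : ∀ t, constantCoeff (L t) = 0 := fun t => by
    refine (hL t).coeff_eq_zero 0 ?_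
    rw [map_zero]
    exact fun h => one_ne_zero (α := ℕ) (by simpa using (congrFun h t).symm)
  have hcard : s.card ≤ r - 2 := by
    refine Finset.card_image_le.trans ?_
    rw [Finset.card_erase_of_mem (by simp [hpq.symm]), Finset.card_erase_of_mem (by simp)]
    simp; omega
  refine (ringKrullDim_le_card_of_isPrime_eq_maximalIdeal s ?_ fun Q hQ hsQ => ?_).trans
    (by exact_mod_cast hcard)
  · intro y hy
    obtain ⟨t, -, rfl⟩ := Finset.mem_image.mp (Finset.mem_coe.mp hy)
    show germ hX (L t) ∈ (maximalIdeal _).comap (Ideal.Quotient.mk P)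
    rw [hcomap]
    exact (germ_mem_maximalIdeal_iff hX).mpr (hconst t)
  · have hP : ∀ z ∈ P, Ideal.Quotient.mk P z ∈ Q := fun z hz => by
      rw [Ideal.Quotient.eq_zero_iff_mem.mpr hz]; exact Q.zero_mem
    have hle := maximalIdeal_le_of_germ_mem hX hL hLX (Q.comap (Ideal.Quotient.mk P)) fun t => by
      by_cases htp : t = p
      · exact hP _ (htp ▸ hp)
      by_cases htq : t = q
      · exact hP _ (htq ▸ hq)
      exact hsQ (Finset.mem_coe.mpr (Finset.mem_image_of_mem _ (by simp [htp, htq])))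
    intro y hy
    obtain ⟨z, rfl⟩ := Ideal.Quotient.mk_surjective y
    exact hle (hcomap ▸ hy : z ∈ _)

end VertexLocalRing

/-! ### Descent from germs to forms, and the minimum of two separating degrees. -/

theorem eval_prod_pow_ne_zero {X : Finset (Space k n)} {L : Fin r → CoordRing k n}
    (hLX : ∀ t, ∀ P ∈ X, eval (fun v : Var n => (P v.1).rep v.2) (L t) ≠ 0)
    (a : Fin r → ℕ) : ∀ P ∈ X, eval (fun v : Var n => (P v.1).rep v.2) (∏ t, L t ^ a t) ≠ 0 := by
  intro P hP
  rw [map_prod]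
  exact Finset.prod_ne_zero_iff.mpr fun t _ => by
    rw [map_pow]; exact pow_ne_zero _ (hLX t P hP)

/-- If a form `G` is divisible by a form `F` in the local ring at the vertex, then the quotient of
the values of `G` and `F` on `X` is given by a form. -/
theorem exists_form_of_germ_dvd {X : Finset (Space k n)} (hX : X.Nonempty) {F G : CoordRing k n}
    {a e : Fin r → ℕ} (hF : F ∈ forms k n a) (hG : G ∈ forms k n (a + e))
    (hdvd : germ hX F ∣ germ hX G) :
    ∃ H ∈ forms k n e, ∀ P ∈ X, eval (fun v : Var n => (P v.1).rep v.2) G =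
      eval (fun v : Var n => (P v.1).rep v.2) F * eval (fun v : Var n => (P v.1).rep v.2) H := by
  -- From s G = F w modulo I_X, the coefficient of T^(a+e) on the cone over P gives s(0) G(P) = F(P)
  -- w_e(P): only the constant term of s contributes, as G already has degree a + e. Hence H = w_e /
  -- s(0).
  obtain ⟨s, w, hs, hmem⟩ := exists_mul_sub_mem_of_germ_dvd hX hdvd
  refine ⟨(constantCoeff s)⁻¹ • weightedHomogeneousComponent (varDegree n) e w,
    Submodule.smul_mem _ _ (weightedHomogeneousComponent_mem _ _ _), fun P hP => ?_⟩
  have h := mem_vanishingIdeal_iff.mp hmem P hP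
  rw [map_sub, sub_eq_zero, map_mul, map_mul, coneEval_of_mem_forms P hF,
    coneEval_of_mem_forms P hG] at h
  have hae : (Finsupp.equivFunOnFinite.symm (a + e) : Fin r →₀ ℕ) =
      Finsupp.equivFunOnFinite.symm a + Finsupp.equivFunOnFinite.symm e := by
    ext t; simp
  have h' := congrArg (coeff (Finsupp.equivFunOnFinite.symm (a + e))) h
  conv_rhs at h' => rw [hae, coeff_monomial_mul, coeff_coneEval]
  have h0 := coeff_mul_monomial (0 : Fin r →₀ ℕ) (Finsupp.equivFunOnFinite.symm (a + e))
    (eval (fun v : Var n => (P v.1).rep v.2) G) (coneEval P s)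
  rw [zero_add, ← constantCoeff_eq, constantCoeff_coneEval] at h0
  rw [h0] at h'
  rw [smul_eval, mul_left_comm, ← h', inv_mul_cancel_left₀ hs]

/-- If `X` is arithmetically Cohen-Macaulay, the multidegrees in which the forms separate the points
of `X` are closed under the componentwise minimum. -/
theorem hilbertFunction_inf_eq_card [Infinite k] {X : Finset (Space k n)}
    (hdepth : idealDepth (irrelevantIdeal k n) (CoordRing k n ⧸ vanishingIdeal X) = r)
    {i j : Fin r → ℕ} (hi : hilbertFunction X i = X.card) (hj : hilbertFunction X j = X.card) :
    hilbertFunction X (i ⊓ j) = X.card := by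
  rw [hilbertFunction_eq_card_iff] at *
  by_contra hm
  simp only [Function.Surjective, not_forall, not_exists] at hm
  obtain ⟨f, hf⟩ := hm
  have hX : X.Nonempty := by
    rw [Finset.nonempty_iff_ne_empty]
    rintro rfl
    exact hf 0 (Subsingleton.elim _ _)
  -- For r = 0 there is only one multidegree, so i and the minimum coincide.
  have hr : r ≠ 0 := by
    rintro rfl
    obtain ⟨F, hF⟩ := hi f
    exact hf ⟨F.1, Subsingleton.elim i (i ⊓ j) ▸ F.2⟩ hF
  choose L hL hLX using exists_linearForm_eval_ne_zero X
  obtain ⟨a, ha⟩ : ∃ a, a + i ⊓ j = i := ⟨i - i ⊓ j, tsub_add_cancel_of_le inf_le_left⟩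
  obtain ⟨b, hb⟩ : ∃ b, b + i ⊓ j = j := ⟨j - i ⊓ j, tsub_add_cancel_of_le inf_le_right⟩
  set c := ∏ t, L t ^ a t
  set d := ∏ t, L t ^ b t
  have hcf : c ∈ forms k n a := prod_pow_mem_forms hL a
  have hdf : d ∈ forms k n b := prod_pow_mem_forms hL b
  have hcX := eval_prod_pow_ne_zero hLX a
  -- The fractions u/c and v/d both represent f, which gives the relation d u = c v.
  obtain ⟨⟨u, huf⟩, hu⟩ := hi fun P => eval (fun v : Var n => (P.1 v.1).rep v.2) c * f P
  obtain ⟨⟨v, hvf⟩, hv⟩ := hj fun P => eval (fun v : Var n => (P.1 v.1).rep v.2) d * f P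
  have hu' : ∀ P (hP : P ∈ X), eval (fun v : Var n => (P v.1).rep v.2) u =
      eval (fun v : Var n => (P v.1).rep v.2) c * f ⟨P, hP⟩ := fun P hP => by
    rw [← congrFun hu ⟨P, hP⟩, evalForms_apply]
  have hv' : ∀ P (hP : P ∈ X), eval (fun v : Var n => (P v.1).rep v.2) v =
      eval (fun v : Var n => (P v.1).rep v.2) d * f ⟨P, hP⟩ := fun P hP => by
    rw [← congrFun hv ⟨P, hP⟩, evalForms_apply]
  have hrel : germ hX d * germ hX u = germ hX c * germ hX v := by
    rw [← sub_eq_zero, ← map_mul, ← map_mul, ← map_sub]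
    refine germ_eq_zero_of_mem hX (mem_vanishingIdeal_of_mem_forms (d := b + i)
      (Submodule.sub_mem _ (IsWeightedHomogeneous.mul hdf huf) ?_) fun P hP => ?_)
    · have : b + i = a + j := by
        conv_lhs => rw [← ha]
        conv_rhs => rw [← hb]
        exact add_left_comm _ _ _
      rw [this]
      exact IsWeightedHomogeneous.mul hcf hvf
    · rw [map_sub, map_mul, map_mul, hu' P hP, hv' P hP]
      ring
  -- A quotient of u by c would yield a form of degree i ⊓ j with values f, against the choice of f.
  have hndvd : ¬ germ hX c ∣ germ hX u := fun h => by
    obtain ⟨H, hH, hHX⟩ := exists_form_of_germ_dvd hX hcf (by rwa [ha]) h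
    refine hf ⟨H, hH⟩ (funext fun P => ?_)
    rw [evalForms_apply]
    exact mul_left_cancel₀ (hcX P.1 P.2) ((hHX P.1 P.2).symm.trans (hu' P.1 P.2))
  obtain ⟨s, hs, hreg, hlen⟩ := exists_isWeaklyRegular_of_idealDepth_eq hdepth hr
  have hsmem : ∀ y ∈ s.map (germ hX), y ∈ maximalIdeal (VertexLocalRing hX) := by
    intro y hy
    obtain ⟨F, hF, rfl⟩ := List.mem_map.mp hy
    exact (germ_mem_maximalIdeal_iff hX).mpr
      (constantCoeff_eq_zero_of_mem_irrelevantIdeal (hs F hF))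
  -- A unit would divide u.
  have hcmem : germ hX c ∈ maximalIdeal (VertexLocalRing hX) := by
    by_contra hunit
    exact hndvd (((notMem_maximalIdeal).mp hunit).dvd)
  obtain ⟨P, hP, hcP, hdP, hdim⟩ := exists_isPrime_of_mul_eq_mul
    (.of_isWeaklyRegular_of_mem_maximalIdeal _ hsmem (isWeaklyRegular_map_germ hX hreg)) hsmem
    hcmem (isSMulRegular_germ hX hcf hcX) hrel hndvd
  have hex : ∀ e : Fin r → ℕ, germ hX (∏ t, L t ^ e t) ∈ P → ∃ t, e t ≠ 0 ∧ germ hX (L t) ∈ P := by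
    intro e he
    rw [map_prod] at he
    obtain ⟨t, -, ht⟩ := hP.prod_mem_iff.mp he
    rw [map_pow] at ht
    refine ⟨t, fun h0 => hP.ne_top ((Ideal.eq_top_iff_one P).mpr ?_), hP.mem_of_pow_mem _ ht⟩
    rwa [h0, pow_zero] at ht
  obtain ⟨p, hap, hp⟩ := hex a hcP
  obtain ⟨q, hbq, hq⟩ := hex b hdP
  -- A nonzero exponent a p means j p < i p, while a nonzero exponent b p means i p < j p.
  have hpq : p ≠ q := by
    rintro rfl
    have h1 : a p + min (i p) (j p) = i p := congrFun ha p
    have h2 : b p + min (i p) (j p) = j p := congrFun hb p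
    omega
  -- This makes the truncated r - 2 a true difference, so that r ≤ s.length ≤ r - 2 + 1 is absurd.
  have hr2 : 2 ≤ r := by
    have := Fin.val_ne_of_ne hpq
    omega
  have hle := ringKrullDim_quotient_le_of_germ_mem hX hL hLX P hpq hp hq
  have : (s.length : WithBot ℕ∞) ≤ ((r - 2 + 1 : ℕ) : WithBot ℕ∞) := by
    rw [List.length_map] at hdim
    refine hdim.trans ?_
    push_cast
    gcongr
  have : s.length ≤ r - 2 + 1 := by exact_mod_cast this
  omega

end Multiprojective

theorem corollary3p6 {k : Type*} [Field k] [IsAlgClosed k] [CharZero k]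
    {r : ℕ} (n : Fin r → ℕ) (X : Finset (Multiprojective.Space k n))
    (h : ∃ i j : Fin r → ℕ,
      Multiprojective.hilbertFunction X i = X.card ∧
      Multiprojective.hilbertFunction X j = X.card ∧
      Multiprojective.hilbertFunction X (fun t => min (i t) (j t)) ≠ X.card) :
    ¬ Multiprojective.IsACM X := by
  obtain ⟨i, j, hi, hj, hij⟩ := h
  exact fun hACM => hij (Multiprojective.hilbertFunction_inf_eq_card hACM.2 hi hj)
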